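/- Let $D$ be an integral domain with quotient field $K$, let $F(D)$ be the set of nonzero fractional ideals of $D$, and let $*:F(D)\to F(D)$, $A\mapsto A_*$, be a star operation on $D$, i.e., for all $A,B\in F(D)$ and $0\neq c\in K$: $A\subseteq A_*=(A_*)_*$; $A\subseteq B$ implies $A_*\subseteq B_*$; $(cA)_*=cA_*$; $D_*=D$. Assume that $*$ is of finite type, i.e., for all $A\in F(D)$, $A_*$ is the union of the $C_*$ over the nonzero finitely generated fractional ideals $C\subseteq A$. An ideal $I$ of $D$ is a valuation ideal if $IV\cap D=I$ for some valuation ring $V$ with $D\subseteq V\subseteq K$. A $*$-ideal is a nonzero ideal $I$ of $D$ with $I_*=I$; it is $*$-finite if $I=J_*$ for some nonzero finitely generated fractional ideal $J$. A maximal $*$-ideal is a maximal element of the set of proper $*$-ideals. A nonzero ideal $I$ is $*$-invertible if $(II^{-1})_*=D$, where $I^{-1}=\{x\in K: xI\subseteq D\}$. Ideals $I,J$ are $*$-comaximal if $(I+J)_*=D$. An ideal $I$ is a finite $*$-product of ideals of some kind if $I=(J_1\cdots J_n)_*$ for some $n\geq 1$ and (nonzero) ideals $J_1,\dots,J_n$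 of that kind; it is a finite $*$-product of $*$-comaximal ideals if moreover $J_i$ and $J_j$ are $*$-comaximal for all $i\neq j$. $D$ is $*$-h-local if each nonzero nonunit of $D$ lies in only finitely many maximal $*$-ideals and each prime $*$-ideal is contained in a unique maximal $*$-ideal. $D$ is a P$*$MD if every nonzero finitely generated ideal of $D$ is $*$-invertible. $D$ is $*$-treed if any two prime $*$-ideals contained in a common prime $*$-ideal are comparable under inclusion. $D$ is a $*$-VIFD if every nonzero principal ideal of $D$ is a finite $*$-product of valuation ideals. Then the following statements are equivalent. 1. $D$ is a $*$-h-local P$*$MD. 2. Every $*$-ideal of $D$ is a finite $*$-product of $*$-comaximal valuation ideals. 2'. Every $*$-finite $*$-ideal of $D$ is a finite $*$-product of $*$-comaximal valuation ideals. 3. Every nonzero principal ideal of $D$ is a finite $*$-product of $*$-comaximal valuation ideals. 4. $D$ is $*$-treed and $D$ is a $*$-VIFD. 5. $D$ is $*$-treed and every nonzero prime ideal of $D$ contains a $*$-invertible valuation ideal. 6. $D$ is $*$-treed and every $*$-ideal of $D$ is a finite $*$-product of valuation ideals. -/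

import Mathlib

open scoped nonZeroDivisors

/-- A star operation on the integral domain `D` with quotient field `K`.  It is a map on the nonzero
fractional ideals of `D`; it is extended to the zero fractional ideal by `0 ↦ 0`. -/
structure StarOperation (D K : Type*) [CommRing D] [IsDomain D] [Field K] [Algebra D K]
    [IsFractionRing D K] where
  /-- `cl A` is `A_*`. -/
  cl : FractionalIdeal D⁰ K → FractionalIdeal D⁰ K
  cl_zero : cl 0 = 0
  le_cl : ∀ A, A ≠ 0 → A ≤ cl A
  cl_idem : ∀ A, A ≠ 0 → cl (cl A) = cl A
  cl_mono : ∀ A B, A ≠ 0 → B ≠ 0 → A ≤ B → cl A ≤ cl B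
  cl_smul : ∀ (c : K) A, c ≠ 0 → A ≠ 0 →
    cl (FractionalIdeal.spanSingleton D⁰ c * A) = FractionalIdeal.spanSingleton D⁰ c * cl A
  cl_one : cl 1 = 1

/-- `I` is a valuation ideal of `D`: there is a valuation overring `V` of `D` (inside the quotient
field `K`) with `IV ∩ D = I`. -/
def IsValuationIdeal {D : Type*} (K : Type*) [CommRing D] [IsDomain D] [Field K] [Algebra D K]
    [IsFractionRing D K] (I : Ideal D) : Prop :=
  ∃ V : Subalgebra D K, ValuationRing V ∧
    (I.map (algebraMap D V)).comap (algebraMap D V) = I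

namespace StarOperation

variable {D K : Type*} [CommRing D] [IsDomain D] [Field K] [Algebra D K] [IsFractionRing D K]

/-- The set `A_{*_f}`, the union of all `C_*` over the nonzero finitely generated fractional ideals
`C ⊆ A`. -/
def finClosure (s : StarOperation D K) (A : FractionalIdeal D⁰ K) : Set K :=
  {x | ∃ C : FractionalIdeal D⁰ K, C ≠ 0 ∧ (C : Submodule D K).FG ∧ C ≤ A ∧ x ∈ s.cl C}

/-- `*` is of finite type: `A_* = A_{*_f}` for all nonzero fractional ideals `A`. -/
def IsFiniteType (s : StarOperation D K) : Prop :=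
  ∀ A : FractionalIdeal D⁰ K, A ≠ 0 → ∀ x : K, x ∈ s.cl A ↔ x ∈ s.finClosure A

/-- An ideal of `D` that is a (by convention nonzero) `*`-ideal. -/
def IsStarIdeal (s : StarOperation D K) (I : Ideal D) : Prop :=
  I ≠ ⊥ ∧ s.cl (I : FractionalIdeal D⁰ K) = (I : FractionalIdeal D⁰ K)

/-- Maximal `*`-ideals: maximal among the proper `*`-ideals. -/
def IsMaximalStarIdeal (s : StarOperation D K) (M : Ideal D) : Prop :=
  Maximal (fun I : Ideal D => s.IsStarIdeal I ∧ I ≠ ⊤) M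

/-- Prime ideals that are (nonzero) `*`-ideals. -/
def IsPrimeStarIdeal (s : StarOperation D K) (P : Ideal D) : Prop :=
  P.IsPrime ∧ s.IsStarIdeal P

/-- `I` is `*`-finite: `I = J_*` for some nonzero finitely generated fractional ideal `J`. -/
def IsStarFinite (s : StarOperation D K) (I : Ideal D) : Prop :=
  ∃ J : FractionalIdeal D⁰ K, J ≠ 0 ∧ (J : Submodule D K).FG ∧
    (I : FractionalIdeal D⁰ K) = s.cl J

/-- `I` is (nonzero and) `*`-invertible: `(I I⁻¹)_* = D`. -/
def IsStarInvertible (s : StarOperation D K) (I : Ideal D) : Prop :=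
  I ≠ ⊥ ∧ s.cl ((I : FractionalIdeal D⁰ K) * (I : FractionalIdeal D⁰ K)⁻¹) = 1

/-- `I` and `J` are `*`-comaximal: `(I + J)_* = D`. -/
def AreStarComaximal (s : StarOperation D K) (I J : Ideal D) : Prop :=
  s.cl ((I ⊔ J : Ideal D) : FractionalIdeal D⁰ K) = 1

/-- `I = (J₁ ⋯ Jₙ)_*` for some `n ≥ 1` and valuation ideals `J₁, …, Jₙ` of `D`. -/
def IsStarProdOfValuationIdeals (s : StarOperation D K) (I : Ideal D) : Prop :=
  ∃ (n : ℕ) (J : Fin n → Ideal D), 1 ≤ n ∧ (∀ i, IsValuationIdeal K (J i)) ∧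
    (I : FractionalIdeal D⁰ K) = s.cl ((∏ i, J i : Ideal D) : FractionalIdeal D⁰ K)

/-- `I = (J₁ ⋯ Jₙ)_*` for some `n ≥ 1` and pairwise `*`-comaximal valuation ideals
`J₁, …, Jₙ` of `D`. -/
def IsStarProdOfComaximalValuationIdeals (s : StarOperation D K) (I : Ideal D) : Prop :=
  ∃ (n : ℕ) (J : Fin n → Ideal D), 1 ≤ n ∧ (∀ i, IsValuationIdeal K (J i)) ∧
    (∀ i j, i ≠ j → s.AreStarComaximal (J i) (J j)) ∧
    (I : FractionalIdeal D⁰ K) = s.cl ((∏ i, J i : Ideal D) : FractionalIdeal D⁰ K)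

/-- `D` is of finite `*`-character. -/
def HasFiniteCharacter (s : StarOperation D K) : Prop :=
  ∀ a : D, a ≠ 0 → ¬ IsUnit a → {M : Ideal D | s.IsMaximalStarIdeal M ∧ a ∈ M}.Finite

/-- `D` is `*`-h-local: of finite `*`-character, and every nonzero prime `*`-ideal is contained in
a unique maximal `*`-ideal. -/
def IsHLocal (s : StarOperation D K) : Prop :=
  s.HasFiniteCharacter ∧
    ∀ P : Ideal D, s.IsPrimeStarIdeal P → ∃! M : Ideal D, s.IsMaximalStarIdeal M ∧ P ≤ M

/-- `D` is a Prüfer `*`-multiplication domain: `(I I⁻¹)_{*_f} = D` for each nonzero finitely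
generated ideal `I`. -/
def IsPruferStarMultiplicationDomain (s : StarOperation D K) : Prop :=
  ∀ I : Ideal D, I ≠ ⊥ → I.FG → ∀ x : K,
    x ∈ s.finClosure ((I : FractionalIdeal D⁰ K) * (I : FractionalIdeal D⁰ K)⁻¹) ↔
      x ∈ (1 : FractionalIdeal D⁰ K)

/-- `D` is `*`-treed: the poset of prime `*`-ideals is treed, that is, the prime `*`-ideals below
a given prime `*`-ideal form a chain. -/
def IsTreed (s : StarOperation D K) : Prop :=
  ∀ P Q R : Ideal D, s.IsPrimeStarIdeal P → s.IsPrimeStarIdeal Q → s.IsPrimeStarIdeal R →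
    P ≤ R → Q ≤ R → P ≤ Q ∨ Q ≤ P

/-- `D` is a `*`-valuation ideal factorization domain. -/
def IsVIFD (s : StarOperation D K) : Prop :=
  ∀ a : D, a ≠ 0 → s.IsStarProdOfValuationIdeals (Ideal.span {a})

end StarOperation

/-! Everything is tested at the maximal `*`-ideals `M`, which are prime and detect membership in
`*`-ideals because `*` has finite type. Localization is written without fractions: an element `t ∉
M` clears denominators. Thus `D` is a P`*`MD iff divisibility is total up to such `t`
(`Ideal.IsEssentialPrime`, that is, `D_M` is a valuation ring), and a `*`-invertible ideal has a
local generator `c`, with `c ∣ t * x` on it.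

In a `*`-h-local P`*`MD, a proper `*`-ideal `I` lies in finitely many maximal `*`-ideals `M`. The
ideals `I D_M ∩ D` are valuation ideals with prime radical; h-locality makes them `*`-comaximal, and
locally their product is `I`.

Conversely, factors of principal ideals are `*`-invertible. If they are also `*`-comaximal, then in
a prime `*`-ideal containing incomparable primes only one factor of `(ab)` survives, and its
valuation ring compares `a` with `b`: `D` is `*`-treed.

The core is the return to h-local P`*`MDs (`isEssentialPrime_of_isTreed`,
`eq_of_isStarInvertible_le`). Treedness makes the intersection of the prime `*`-ideals between
`(ab)` and `M` prime. A `*`-invertible valuation ideal inside it has a local generator `c` with a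
power divisible by `ab`, and its valuation ring then decides locally between `a ∣ b` and `b ∣ a`.
Such an ideal lies in at most one maximal `*`-ideal, and an Oka family argument turns this into
finite character. -/

theorem Ideal.exists_mem_of_fg_le_sSup_of_isChain {R : Type*} [CommRing R] {c : Set (Ideal R)}
    (hne : c.Nonempty) (hc : IsChain (· ≤ ·) c) {C : Ideal R} (hC : C.FG) (hle : C ≤ sSup c) :
    ∃ I ∈ c, C ≤ I := by
  classical
  obtain ⟨S, rfl⟩ := hC
  induction S using Finset.induction_on with
  | empty =>
    obtain ⟨I, hI⟩ := hne
    exact ⟨I, hI, by simp⟩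
  | insert a S _ ih =>
    rw [Finset.coe_insert, Ideal.span_insert, sup_le_iff] at hle
    obtain ⟨I, hI, hSI⟩ := ih hle.2
    obtain ⟨J, hJ, haJ⟩ := (Submodule.mem_sSup_of_directed hne hc.directedOn).1
      (hle.1 (Ideal.mem_span_singleton_self a))
    have key : ∀ L ∈ c, I ≤ L → J ≤ L →
        ∃ L ∈ c, Ideal.span (↑(insert a S) : Set R) ≤ L := by
      intro L hL hIL hJL
      refine ⟨L, hL, ?_⟩
      rw [Finset.coe_insert, Ideal.span_insert, sup_le_iff]
      exact ⟨(Ideal.span_singleton_le_iff_mem _).2 (hJL haJ), hSI.trans hIL⟩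
    rcases hc.total hI hJ with h | h
    · exact key J hJ h le_rfl
    · exact key I hI le_rfl h

/-! ### The closure on integral ideals, prime `*`-ideals and maximal `*`-ideals. -/

namespace StarOperation

variable {D K : Type*} [CommRing D] [IsDomain D] [Field K] [Algebra D K] [IsFractionRing D K]

/-- The star closure of an integral ideal, as an integral ideal. -/
def idealCl (s : StarOperation D K) (J : Ideal D) : Ideal D :=
  (s.cl (J : FractionalIdeal D⁰ K) : Submodule D K).comap (Algebra.linearMap D K)

variable {s : StarOperation D K} {I J M : Ideal D}

theorem mem_idealCl {x : D} :
    x ∈ s.idealCl J ↔ algebraMap D K x ∈ s.cl (J : FractionalIdeal D⁰ K) := Iff.rfl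

theorem cl_le_one {A : FractionalIdeal D⁰ K} (hA : A ≤ 1) : s.cl A ≤ 1 := by
  by_cases h : A = 0
  · rw [h, s.cl_zero]; exact bot_le
  · have := s.cl_mono A 1 h one_ne_zero hA
    rwa [s.cl_one] at this

theorem le_cl' (A : FractionalIdeal D⁰ K) : A ≤ s.cl A := by
  by_cases h : A = 0
  · rw [h, s.cl_zero]
  · exact s.le_cl A h

theorem cl_mono' {A B : FractionalIdeal D⁰ K} (h : A ≤ B) : s.cl A ≤ s.cl B := by
  by_cases hA : A = 0
  · rw [hA, s.cl_zero]; exact bot_le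
  · refine s.cl_mono A B hA ?_ h
    rintro rfl
    exact hA (le_antisymm h (bot_le))

theorem cl_idem' (A : FractionalIdeal D⁰ K) : s.cl (s.cl A) = s.cl A := by
  by_cases h : A = 0
  · rw [h, s.cl_zero, s.cl_zero]
  · exact s.cl_idem A h

theorem cl_smul' (c : K) (A : FractionalIdeal D⁰ K) :
    s.cl (FractionalIdeal.spanSingleton D⁰ c * A) = FractionalIdeal.spanSingleton D⁰ c * s.cl A := by
  by_cases hc : c = 0
  · simp [hc, s.cl_zero]
  by_cases h : A = 0
  · simp [h, s.cl_zero]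
  · exact s.cl_smul c A hc h

theorem coe_idealCl (s : StarOperation D K) (J : Ideal D) :
    (s.idealCl J : FractionalIdeal D⁰ K) = s.cl (J : FractionalIdeal D⁰ K) := by
  ext x
  rw [FractionalIdeal.mem_coeIdeal]
  constructor
  · rintro ⟨y, hy, rfl⟩
    exact hy
  · intro hx
    obtain ⟨y, rfl⟩ := (FractionalIdeal.mem_one_iff _).1
      (cl_le_one FractionalIdeal.coeIdeal_le_one hx)
    exact ⟨y, hx, rfl⟩

theorem coe_eq_cl_iff : (I : FractionalIdeal D⁰ K) = s.cl (J : FractionalIdeal D⁰ K) ↔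
    I = s.idealCl J := by
  rw [← coe_idealCl, FractionalIdeal.coeIdeal_inj]

theorem isStarIdeal_iff : s.IsStarIdeal I ↔ I ≠ ⊥ ∧ s.idealCl I = I := by
  unfold IsStarIdeal
  rw [← coe_idealCl, FractionalIdeal.coeIdeal_inj]

theorem le_idealCl : J ≤ s.idealCl J := fun _ hx =>
  le_cl' _ (FractionalIdeal.mem_coeIdeal_of_mem _ hx)

theorem idealCl_mono (h : I ≤ J) : s.idealCl I ≤ s.idealCl J := fun _ hx =>
  cl_mono' (FractionalIdeal.coeIdeal_le_coeIdeal K |>.2 h) hx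

theorem idealCl_idem : s.idealCl (s.idealCl J) = s.idealCl J := by
  rw [← FractionalIdeal.coeIdeal_inj (K := K), coe_idealCl, coe_idealCl, cl_idem']

theorem idealCl_le (hM : s.idealCl M = M) (h : J ≤ M) : s.idealCl J ≤ M :=
  (idealCl_mono h).trans hM.le

theorem idealCl_span_mul (a : D) :
    s.idealCl (Ideal.span {a} * J) = Ideal.span {a} * s.idealCl J := by
  rw [← FractionalIdeal.coeIdeal_inj (K := K), coe_idealCl, FractionalIdeal.coeIdeal_mul,
    FractionalIdeal.coeIdeal_mul, FractionalIdeal.coeIdeal_span_singleton, cl_smul', coe_idealCl]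

theorem idealCl_top : s.idealCl ⊤ = ⊤ := top_le_iff.1 le_idealCl

theorem idealCl_span (a : D) : s.idealCl (Ideal.span {a}) = Ideal.span {a} := by
  have := idealCl_span_mul (s := s) (J := ⊤) a
  rwa [idealCl_top, Ideal.mul_top] at this

theorem isStarIdeal_span {a : D} (ha : a ≠ 0) : s.IsStarIdeal (Ideal.span {a}) :=
  isStarIdeal_iff.2 ⟨by simpa using ha, idealCl_span a⟩

theorem mul_mem_idealCl {a x : D} (hx : x ∈ s.idealCl J) (h : ∀ y ∈ J, a * y ∈ I) :
    a * x ∈ s.idealCl I := by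
  have h1 : Ideal.span {a} * J ≤ I := by
    rw [Ideal.span_singleton_mul_le_iff]; exact h
  refine idealCl_mono h1 ?_
  rw [idealCl_span_mul]
  exact Ideal.mul_mem_mul (Ideal.mem_span_singleton_self a) hx

theorem mul_idealCl_le : s.idealCl I * s.idealCl J ≤ s.idealCl (I * J) := by
  rw [Ideal.mul_le]
  intro x hx y hy
  rw [← idealCl_idem]
  refine mul_mem_idealCl hy fun z hz => ?_
  rw [mul_comm x z]
  exact mul_mem_idealCl hx fun w hw => by
    rw [mul_comm z w]; exact Ideal.mul_mem_mul hw hz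

theorem areStarComaximal_iff : s.AreStarComaximal I J ↔ s.idealCl (I ⊔ J) = ⊤ := by
  unfold AreStarComaximal
  rw [← coe_idealCl, ← FractionalIdeal.coeIdeal_top, FractionalIdeal.coeIdeal_inj]

theorem mem_idealCl_iff_exists_fg (hs : s.IsFiniteType) {x : D} :
    x ∈ s.idealCl J ↔ ∃ C : Ideal D, C.FG ∧ C ≤ J ∧ x ∈ s.idealCl C := by
  constructor
  · intro hx
    by_cases hJ : J = ⊥
    · exact ⟨J, hJ ▸ Submodule.fg_bot, le_rfl, hx⟩
    obtain ⟨C, -, hfg, hCJ, hxC⟩ := (hs _ (FractionalIdeal.coeIdeal_ne_zero.2 hJ) _).1 hx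
    obtain ⟨C, rfl⟩ := FractionalIdeal.le_one_iff_exists_coeIdeal.1
      (hCJ.trans FractionalIdeal.coeIdeal_le_one)
    exact ⟨C, (FractionalIdeal.coeIdeal_fg _ (IsFractionRing.injective D K) C).1 hfg,
      (FractionalIdeal.coeIdeal_le_coeIdeal K).1 hCJ, hxC⟩
  · rintro ⟨C, -, hCJ, hx⟩
    exact idealCl_mono hCJ hx

/-- An ideal maximal among those whose star closure avoids a multiplicative set is a prime
star ideal. -/
theorem exists_maximal_disjoint (hs : s.IsFiniteType) (T : Submonoid D)
    (hJ : ∀ t ∈ T, t ∉ s.idealCl J) :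
    ∃ Q : Ideal D, J ≤ Q ∧ Q.IsPrime ∧ s.idealCl Q = Q ∧
      Maximal (fun I : Ideal D => ∀ t ∈ T, t ∉ s.idealCl I) Q := by
  -- Finite type makes Zorn apply: a `t` in the closure of the union of a chain is in the closure of
  -- a finitely generated ideal, which sits inside one member.
  obtain ⟨Q, hJQ, hQ⟩ := zorn_le_nonempty₀ {I : Ideal D | ∀ t ∈ T, t ∉ s.idealCl I}
    (fun c hc hchain I hI => ⟨sSup c, fun t ht htc => by
      obtain ⟨C, hC, hCc, htC⟩ := (mem_idealCl_iff_exists_fg hs).1 htc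
      obtain ⟨L, hL, hCL⟩ := Ideal.exists_mem_of_fg_le_sSup_of_isChain ⟨I, hI⟩ hchain hC hCc
      exact hc hL t ht (idealCl_mono hCL htC), fun L hL => le_sSup hL⟩) J hJ
  have hcl : s.idealCl Q = Q := le_antisymm
    (hQ.2 (show s.idealCl Q ∈ {I : Ideal D | ∀ t ∈ T, t ∉ s.idealCl I} by
      intro t ht; rw [idealCl_idem]; exact hQ.1 t ht) le_idealCl) le_idealCl
  refine ⟨Q, hJQ, ⟨?_, ?_⟩, hcl, hQ⟩
  · rintro rfl
    exact hQ.1 1 T.one_mem (by rw [hcl]; trivial)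
  · intro x y hxy
    by_contra! hcon
    have key : ∀ z, z ∉ Q → ∃ t ∈ T, t ∈ s.idealCl (Q ⊔ Ideal.span {z}) := by
      intro z hz
      by_contra! hz'
      exact hz (hQ.2 (show Q ⊔ Ideal.span {z} ∈ _ from hz') le_sup_left
        (Ideal.mem_sup_right (Ideal.mem_span_singleton_self z)))
    obtain ⟨t, ht, htx⟩ := key x hcon.1
    obtain ⟨u, hu, huy⟩ := key y hcon.2
    refine hQ.1 (t * u) (T.mul_mem ht hu) (idealCl_mono ?_ (mul_idealCl_le
      (Ideal.mul_mem_mul htx huy)))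
    rw [Ideal.sup_mul, Ideal.mul_sup, Ideal.mul_sup, Ideal.span_singleton_mul_span_singleton]
    refine sup_le (sup_le Ideal.mul_le_left Ideal.mul_le_left) (sup_le Ideal.mul_le_right ?_)
    rwa [Ideal.span_singleton_le_iff_mem]

theorem IsMaximalStarIdeal.idealCl_eq (hM : s.IsMaximalStarIdeal M) : s.idealCl M = M :=
  (isStarIdeal_iff.1 hM.1.1).2

theorem exists_le_isMaximalStarIdeal (hs : s.IsFiniteType) (h0 : J ≠ ⊥) (hJ : s.idealCl J ≠ ⊤) :
    ∃ M : Ideal D, s.IsMaximalStarIdeal M ∧ M.IsPrime ∧ J ≤ M := by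
  obtain ⟨Q, hJQ, hQp, hQ, hmax⟩ := exists_maximal_disjoint (J := J) hs ⊥ (by
    rintro t ht h
    rw [Submonoid.mem_bot.1 ht] at h
    exact hJ ((Ideal.eq_top_iff_one _).2 h))
  refine ⟨Q, ⟨⟨isStarIdeal_iff.2 ⟨?_, hQ⟩, hQp.ne_top⟩, ?_⟩, hQp, hJQ⟩
  · rintro rfl
    exact h0 (le_bot_iff.1 hJQ)
  · rintro I ⟨hI, hIt⟩ hQI
    refine hmax.2 ?_ hQI
    rintro t ht h
    rw [Submonoid.mem_bot.1 ht, (isStarIdeal_iff.1 hI).2] at h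
    exact hIt ((Ideal.eq_top_iff_one _).2 h)

theorem IsMaximalStarIdeal.isPrime (hs : s.IsFiniteType) (hM : s.IsMaximalStarIdeal M) :
    M.IsPrime := by
  obtain ⟨N, hN, hNp, hMN⟩ := exists_le_isMaximalStarIdeal hs (isStarIdeal_iff.1 hM.1.1).1
    (by rw [hM.idealCl_eq]; exact hM.1.2)
  rwa [hM.eq_of_le hN.1 hMN]

theorem IsMaximalStarIdeal.isPrimeStarIdeal (hs : s.IsFiniteType) (hM : s.IsMaximalStarIdeal M) :
    s.IsPrimeStarIdeal M := ⟨hM.isPrime hs, hM.1.1⟩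

theorem IsMaximalStarIdeal.exists_mem_notMem {N : Ideal D} (hM : s.IsMaximalStarIdeal M)
    (hN : s.IsMaximalStarIdeal N) (h : M ≠ N) : ∃ a ∈ M, a ∉ N :=
  Set.not_subset.1 fun hle => h (hM.eq_of_le hN.1 hle)

/-- A star ideal is determined by its localizations at the maximal star ideals. -/
theorem mem_idealCl_of_forall (hs : s.IsFiniteType) (hI : I ≠ ⊥) {x : D}
    (h : ∀ M, s.IsMaximalStarIdeal M → ∃ t ∉ M, t * x ∈ I) : x ∈ s.idealCl I := by
  -- The conductor of `x` into `I` lies in no maximal `*`-ideal, so its closure contains 1; multiply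
  -- by `x`.
  set A : Ideal D := I.colon (Ideal.span {x}) with hA
  have hmem : ∀ y, y ∈ A ↔ y * x ∈ I := fun y => by
    rw [hA, Ideal.mem_colon_span_singleton]
  have hIA : I ≤ A := fun y hy => (hmem y).2 (I.mul_mem_right x hy)
  have hAt : s.idealCl A = ⊤ := by
    by_contra hne
    obtain ⟨M, hM, -, hAM⟩ := exists_le_isMaximalStarIdeal hs
      (fun h0 => hI (le_bot_iff.1 (h0 ▸ hIA))) hne
    obtain ⟨t, ht, htx⟩ := h M hM
    exact ht (hAM ((hmem t).2 htx))
  have := mul_mem_idealCl (s := s) (J := A) (I := I) (a := x) (x := 1) (by rw [hAt]; trivial)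
    fun y hy => by rw [mul_comm]; exact (hmem y).1 hy
  rwa [mul_one] at this

end StarOperation

/-! ### Essential primes and finitely generated ideals. -/

/-- The localization of `D` at the complement of `M` has totally ordered divisibility. -/
def Ideal.IsEssentialPrime {D : Type*} [CommRing D] (M : Ideal D) : Prop :=
  ∀ a b : D, ∃ t ∉ M, a ∣ t * b ∨ b ∣ t * a

theorem Submodule.exists_fg_mul_of_fg_le_mul {R A : Type*} [CommRing R] [CommRing A] [Algebra R A]
    {I B F : Submodule R A} (hF : F.FG) (h : F ≤ I * B) :
    ∃ C : Submodule R A, C.FG ∧ C ≤ I ∧ F ≤ C * B := by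
  have hmem : ∀ x ∈ I * B, ∃ C : Submodule R A, C.FG ∧ C ≤ I ∧ x ∈ C * B := by
    intro x hx
    induction hx using Submodule.mul_induction_on' with
    | mem_mul_mem m hm n hn =>
      exact ⟨_, Submodule.fg_span_singleton m, (Submodule.span_singleton_le_iff_mem _ _).2 hm,
        Submodule.mul_mem_mul (Submodule.mem_span_singleton_self m) hn⟩
    | add x _ y _ hx hy =>
      obtain ⟨C, hC, hCI, hxC⟩ := hx
      obtain ⟨E, hE, hEI, hyE⟩ := hy
      exact ⟨C ⊔ E, hC.sup hE, sup_le hCI hEI, add_mem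
        ((mul_le_mul' le_sup_left le_rfl : C * B ≤ _) hxC)
        ((mul_le_mul' le_sup_right le_rfl : E * B ≤ _) hyE)⟩
  induction F, hF using Submodule.fg_induction with
  | singleton x =>
    obtain ⟨C, hC, hCI, hx⟩ := hmem x (h (Submodule.mem_span_singleton_self x))
    exact ⟨C, hC, hCI, (Submodule.span_singleton_le_iff_mem _ _).2 hx⟩
  | sup F₁ F₂ _ _ h₁ h₂ =>
    obtain ⟨C, hC, hCI, hx⟩ := h₁ (le_sup_left.trans h)
    obtain ⟨E, hE, hEI, hy⟩ := h₂ (le_sup_right.trans h)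
    exact ⟨C ⊔ E, hC.sup hE, sup_le hCI hEI, sup_le
      (hx.trans (mul_le_mul' le_sup_left le_rfl))
      (hy.trans (mul_le_mul' le_sup_right le_rfl))⟩

theorem Ideal.ne_zero_of_forall_dvd_mul {D : Type*} [CommRing D] [IsDomain D] {I M : Ideal D}
    (hI : I ≠ ⊥) {c t : D} (ht : t ∉ M) (h : ∀ x ∈ I, c ∣ t * x) : c ≠ 0 := by
  rintro rfl
  obtain ⟨x, hx, hx0⟩ := (Submodule.ne_bot_iff _).1 hI
  rcases mul_eq_zero.1 (zero_dvd_iff.1 (h x hx)) with h0 | h0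
  · exact ht (h0 ▸ M.zero_mem)
  · exact hx0 h0

theorem Ideal.IsEssentialPrime.exists_dvd_of_fg {D : Type*} [CommRing D] {M : Ideal D}
    (hM : M.IsEssentialPrime) [hp : M.IsPrime] {C : Ideal D} (hC : C.FG) :
    ∃ c ∈ C, ∃ t ∉ M, ∀ x ∈ C, c ∣ t * x := by
  induction C, hC using Submodule.fg_induction with
  | singleton x =>
    refine ⟨x, Ideal.mem_span_singleton_self x, 1, hp.one_notMem, fun y hy => ?_⟩
    rw [one_mul]
    exact Ideal.mem_span_singleton.1 hy
  | sup C E _ _ h₁ h₂ =>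
    obtain ⟨c, hc, t, ht, htc⟩ := h₁
    obtain ⟨e, he, u, hu, hue⟩ := h₂
    obtain ⟨w, hw, h⟩ := hM c e
    have hn : t * u * w ∉ M := hp.mul_notMem (hp.mul_notMem ht hu) hw
    rcases h with h | h
    · refine ⟨c, Ideal.mem_sup_left hc, _, hn, fun x hx => ?_⟩
      obtain ⟨y, hy, z, hz, rfl⟩ := Submodule.mem_sup.1 hx
      rw [mul_add]
      refine dvd_add ?_ ?_
      · rw [show t * u * w * y = (t * y) * (u * w) by ring]
        exact (htc y hy).mul_right _
      · obtain ⟨r, hr⟩ := hue z hz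
        rw [show t * u * w * z = (u * z) * w * t by ring, hr,
          show e * r * w * t = (w * e) * (r * t) by ring]
        exact h.mul_right _
    · refine ⟨e, Ideal.mem_sup_right he, _, hn, fun x hx => ?_⟩
      obtain ⟨y, hy, z, hz, rfl⟩ := Submodule.mem_sup.1 hx
      rw [mul_add]
      refine dvd_add ?_ ?_
      · obtain ⟨r, hr⟩ := htc y hy
        rw [show t * u * w * y = (t * y) * w * u by ring, hr,
          show c * r * w * u = (w * c) * (r * u) by ring]
        exact h.mul_right _
      · rw [show t * u * w * z = (u * z) * (t * w) by ring]
        exact (hue z hz).mul_right _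

/-! ### `*`-invertibility and the local form of the P`*`MD condition. -/

namespace StarOperation

variable {D K : Type*} [CommRing D] [IsDomain D] [Field K] [Algebra D K] [IsFractionRing D K]
variable {s : StarOperation D K} {I J M : Ideal D}

theorem cl_eq_one_iff {A : FractionalIdeal D⁰ K} (hA : A ≤ 1) :
    s.cl A = 1 ↔ (1 : K) ∈ s.cl A := by
  refine ⟨fun h => h ▸ FractionalIdeal.one_mem_one D⁰, fun h => le_antisymm (cl_le_one hA) ?_⟩
  exact FractionalIdeal.one_le.2 h

theorem mul_inv_le_one (I : Ideal D) :
    (I : FractionalIdeal D⁰ K) * (I : FractionalIdeal D⁰ K)⁻¹ ≤ 1 := by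
  by_cases hI : I = ⊥
  · simp [hI]
  rw [FractionalIdeal.mul_le]
  intro x hx y hy
  rw [mul_comm]
  exact (FractionalIdeal.mem_inv_iff (FractionalIdeal.coeIdeal_ne_zero.2 hI)).1 hy x hx

/-- Since `I I⁻¹` is not inside `M`, some `c ∈ I` and `b ∈ I⁻¹` have `t = c b ∉ M`; then `t x = c (b
x)` with `b x ∈ D`. -/
theorem IsStarInvertible.exists_dvd (hI : s.IsStarInvertible I) (hM : s.idealCl M = M)
    (hM1 : M ≠ ⊤) : ∃ c ∈ I, ∃ t ∉ M, ∀ x ∈ I, c ∣ t * x := by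
  have hnle : ¬ (I : FractionalIdeal D⁰ K) * (I : FractionalIdeal D⁰ K)⁻¹ ≤
      (M : FractionalIdeal D⁰ K) := by
    intro h
    have h1 := cl_mono' (s := s) h
    rw [hI.2, ← coe_idealCl, hM, ← FractionalIdeal.coeIdeal_top,
      FractionalIdeal.coeIdeal_le_coeIdeal] at h1
    exact hM1 (top_le_iff.1 h1)
  rw [FractionalIdeal.mul_le] at hnle
  push Not at hnle
  obtain ⟨c, hc, b, hb, hcb⟩ := hnle
  obtain ⟨c, hcI, rfl⟩ := (FractionalIdeal.mem_coeIdeal _).1 hc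
  have hb' := (FractionalIdeal.mem_inv_iff (FractionalIdeal.coeIdeal_ne_zero.2 hI.1)).1 hb
  have hbI : ∀ x ∈ I, ∃ r, algebraMap D K r = b * algebraMap D K x := fun x hx =>
    (FractionalIdeal.mem_one_iff _).1 (hb' _ (FractionalIdeal.mem_coeIdeal_of_mem _ hx))
  obtain ⟨t, ht⟩ := hbI c hcI
  refine ⟨c, hcI, t, fun htM => hcb ?_, fun x hx => ?_⟩
  · rw [mul_comm, ← ht]
    exact FractionalIdeal.mem_coeIdeal_of_mem _ htM
  · obtain ⟨r, hr⟩ := hbI x hx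
    refine ⟨r, IsFractionRing.injective D K ?_⟩
    rw [map_mul, map_mul, ht, hr]
    ring

theorem dvd_of_mem_idealCl {c t x : D} (h : ∀ x ∈ I, c ∣ t * x) (hx : x ∈ s.idealCl I) :
    c ∣ t * x := by
  rw [← Ideal.mem_span_singleton, ← idealCl_span (s := s) c]
  exact mul_mem_idealCl hx fun y hy => Ideal.mem_span_singleton.2 (h y hy)

/-- Finite type puts 1 in the closure of a finitely generated `F ⊆ I I⁻¹`, and `F ⊆ C I⁻¹` for some
finitely generated `C ⊆ I`. For `x ∈ I`, `x F ⊆ C I I⁻¹ ⊆ C`, so `x` lies in the closure of `C`. -/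
theorem IsStarInvertible.exists_fg (hs : s.IsFiniteType) (hI : s.IsStarInvertible I) :
    ∃ C : Ideal D, C.FG ∧ C ≤ I ∧ ∀ M, s.idealCl M = M → C ≤ M → I ≤ M := by
  have hI0 : (I : FractionalIdeal D⁰ K) ≠ 0 := FractionalIdeal.coeIdeal_ne_zero.2 hI.1
  have hA0 : (I : FractionalIdeal D⁰ K) * (I : FractionalIdeal D⁰ K)⁻¹ ≠ 0 := by
    intro h
    have := hI.2
    rw [h, s.cl_zero] at this
    exact zero_ne_one this
  have h1 : (1 : K) ∈ s.cl ((I : FractionalIdeal D⁰ K) * (I : FractionalIdeal D⁰ K)⁻¹) :=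
    (cl_eq_one_iff (mul_inv_le_one I)).1 hI.2
  obtain ⟨F, -, hF, hFI, h1F⟩ := (hs _ hA0 1).1 h1
  obtain ⟨C, hC, hCI, hFC⟩ := Submodule.exists_fg_mul_of_fg_le_mul (I := (I : FractionalIdeal D⁰ K))
    (B := ((I : FractionalIdeal D⁰ K)⁻¹ : FractionalIdeal D⁰ K)) hF
    (by rw [← FractionalIdeal.coe_mul]; exact hFI)
  set C' : Ideal D := C.comap (Algebra.linearMap D K) with hC'
  have hCC : C = ((C' : FractionalIdeal D⁰ K) : Submodule D K) := by
    ext x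
    constructor
    · intro hx
      obtain ⟨y, -, rfl⟩ := (FractionalIdeal.mem_coeIdeal _).1 (hCI hx)
      exact FractionalIdeal.mem_coeIdeal_of_mem _ hx
    · intro hx
      obtain ⟨y, hy, rfl⟩ := (FractionalIdeal.mem_coeIdeal _).1 hx
      exact hy
  refine ⟨C', ?_, ?_, fun M hM hCM x hx => ?_⟩
  · rw [hCC] at hC
    exact (FractionalIdeal.coeIdeal_fg _ (IsFractionRing.injective D K) C').1 hC
  · rw [← FractionalIdeal.coeIdeal_le_coeIdeal K]
    intro x hx
    exact hCI (by rw [hCC]; exact hx)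
  · have hF1 : F ≤ (C' : FractionalIdeal D⁰ K) * (I : FractionalIdeal D⁰ K)⁻¹ := by
      rw [← FractionalIdeal.coe_le_coe, FractionalIdeal.coe_mul, ← hCC]
      exact hFC
    have hxF : FractionalIdeal.spanSingleton D⁰ (algebraMap D K x) * F ≤
        (M : FractionalIdeal D⁰ K) := by
      calc FractionalIdeal.spanSingleton D⁰ (algebraMap D K x) * F
          ≤ (I : FractionalIdeal D⁰ K) *
              ((C' : FractionalIdeal D⁰ K) * (I : FractionalIdeal D⁰ K)⁻¹) := by
            refine mul_le_mul' ?_ hF1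
            rw [FractionalIdeal.spanSingleton_le_iff_mem]
            exact FractionalIdeal.mem_coeIdeal_of_mem _ hx
        _ = (C' : FractionalIdeal D⁰ K) *
              ((I : FractionalIdeal D⁰ K) * (I : FractionalIdeal D⁰ K)⁻¹) := by ring
        _ ≤ (C' : FractionalIdeal D⁰ K) * 1 := mul_le_mul' le_rfl (mul_inv_le_one I)
        _ ≤ (M : FractionalIdeal D⁰ K) := by
            rw [mul_one]; exact (FractionalIdeal.coeIdeal_le_coeIdeal K).2 hCM
    have h2 := cl_mono' (s := s) hxF
    rw [cl_smul', ← coe_idealCl, hM] at h2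
    have h3 := h2 (FractionalIdeal.mul_mem_mul (FractionalIdeal.mem_spanSingleton_self D⁰ _) h1F)
    rw [mul_one] at h3
    obtain ⟨y, hy, hyx⟩ := (FractionalIdeal.mem_coeIdeal _).1 h3
    rwa [← IsFractionRing.injective D K hyx]

/-- The fractional ideal `a⁻¹ J B` is contained in `J J⁻¹` and already has closure `D`. -/
theorem isStarInvertible_of_span_eq {a : D} (ha : a ≠ 0) {B : Ideal D}
    (h : Ideal.span {a} = s.idealCl (J * B)) : s.IsStarInvertible J := by
  have ha' : algebraMap D K a ≠ 0 := by simpa using ha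
  have hJ : J ≠ ⊥ := by
    rintro rfl
    have h1 : a ∈ s.idealCl (⊥ * B) := h ▸ Ideal.mem_span_singleton_self a
    rw [Ideal.bot_mul, mem_idealCl, FractionalIdeal.coeIdeal_bot, s.cl_zero,
      FractionalIdeal.mem_zero_iff] at h1
    exact ha' h1
  have hJ0 : (J : FractionalIdeal D⁰ K) ≠ 0 := FractionalIdeal.coeIdeal_ne_zero.2 hJ
  refine ⟨hJ, (cl_eq_one_iff (mul_inv_le_one J)).2 ?_⟩
  have hle : FractionalIdeal.spanSingleton D⁰ (algebraMap D K a)⁻¹ * ((J * B : Ideal D) :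
      FractionalIdeal D⁰ K) ≤ (J : FractionalIdeal D⁰ K) * (J : FractionalIdeal D⁰ K)⁻¹ := by
    rw [FractionalIdeal.coeIdeal_mul, mul_left_comm]
    refine mul_le_mul' le_rfl ?_
    rw [FractionalIdeal.spanSingleton_mul_le_iff]
    intro z hz
    obtain ⟨b, hb, rfl⟩ := (FractionalIdeal.mem_coeIdeal _).1 hz
    rw [FractionalIdeal.mem_inv_iff hJ0]
    intro y hy
    obtain ⟨j, hj, rfl⟩ := (FractionalIdeal.mem_coeIdeal _).1 hy
    have : j * b ∈ Ideal.span {a} := h ▸ le_idealCl (Ideal.mul_mem_mul hj hb)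
    obtain ⟨r, hr⟩ := Ideal.mem_span_singleton.1 this
    rw [FractionalIdeal.mem_one_iff]
    refine ⟨r, ?_⟩
    have hr' := congrArg (algebraMap D K) hr
    rw [map_mul, map_mul] at hr'
    field_simp
    linear_combination -hr'
  refine cl_mono' hle ?_
  rw [cl_smul', ← coe_idealCl, ← h, FractionalIdeal.coeIdeal_span_singleton,
    FractionalIdeal.spanSingleton_mul_spanSingleton, inv_mul_cancel₀ ha',
    FractionalIdeal.spanSingleton_one]
  exact FractionalIdeal.one_mem_one D⁰

theorem isStarInvertible_of_forall (hs : s.IsFiniteType) (hI : I ≠ ⊥)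
    (h : ∀ M, s.IsMaximalStarIdeal M → ∃ c ∈ I, ∃ t ∉ M, ∀ x ∈ I, c ∣ t * x) :
    s.IsStarInvertible I := by
  have hI0 : (I : FractionalIdeal D⁰ K) ≠ 0 := FractionalIdeal.coeIdeal_ne_zero.2 hI
  refine ⟨hI, ?_⟩
  obtain ⟨A, hA⟩ := FractionalIdeal.le_one_iff_exists_coeIdeal.1 (mul_inv_le_one (K := K) I)
  rw [← hA, ← coe_idealCl, ← FractionalIdeal.coeIdeal_top, FractionalIdeal.coeIdeal_inj]
  by_contra hne
  have hA0 : A ≠ ⊥ := by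
    rintro rfl
    have h1 := FractionalIdeal.coe_ideal_le_self_mul_inv K I
    rw [← hA, FractionalIdeal.coeIdeal_bot] at h1
    exact hI0 (le_antisymm h1 bot_le)
  obtain ⟨M, hM, hMp, hAM⟩ := exists_le_isMaximalStarIdeal hs hA0 hne
  obtain ⟨c, hc, t, ht, htc⟩ := h M hM
  have hc0 : c ≠ 0 := Ideal.ne_zero_of_forall_dvd_mul hI ht htc
  have hc0' : algebraMap D K c ≠ 0 := by simpa using hc0
  refine ht (hAM ?_)
  have hmem : algebraMap D K t ∈ (A : FractionalIdeal D⁰ K) := by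
    rw [hA, show algebraMap D K t = algebraMap D K c * (algebraMap D K t / algebraMap D K c) by
      field_simp]
    refine FractionalIdeal.mul_mem_mul (FractionalIdeal.mem_coeIdeal_of_mem _ hc) ?_
    rw [FractionalIdeal.mem_inv_iff hI0]
    intro y hy
    obtain ⟨x, hx, rfl⟩ := (FractionalIdeal.mem_coeIdeal _).1 hy
    obtain ⟨r, hr⟩ := htc x hx
    rw [FractionalIdeal.mem_one_iff]
    refine ⟨r, ?_⟩
    have hr' := congrArg (algebraMap D K) hr
    rw [map_mul, map_mul] at hr'
    field_simp
    linear_combination -hr'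
  obtain ⟨y, hy, hyt⟩ := (FractionalIdeal.mem_coeIdeal _).1 hmem
  rwa [← IsFractionRing.injective D K hyt]

theorem isPruferStarMultiplicationDomain_iff_isStarInvertible (hs : s.IsFiniteType) :
    s.IsPruferStarMultiplicationDomain ↔ ∀ I : Ideal D, I ≠ ⊥ → I.FG → s.IsStarInvertible I := by
  refine forall₃_congr fun I hI _ => ?_
  have hA0 : (I : FractionalIdeal D⁰ K) * (I : FractionalIdeal D⁰ K)⁻¹ ≠ 0 := by
    intro h
    have h1 := FractionalIdeal.coe_ideal_le_self_mul_inv K I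
    rw [h] at h1
    exact FractionalIdeal.coeIdeal_ne_zero.2 hI (le_antisymm h1 bot_le)
  simp only [← hs _ hA0]
  exact ⟨fun h => ⟨hI, FractionalIdeal.ext h⟩, fun h x => by rw [h.2]⟩

theorem isPruferStarMultiplicationDomain_iff (hs : s.IsFiniteType) :
    s.IsPruferStarMultiplicationDomain ↔
      ∀ M : Ideal D, s.IsMaximalStarIdeal M → M.IsEssentialPrime := by
  rw [isPruferStarMultiplicationDomain_iff_isStarInvertible hs]
  constructor
  · intro h M hM a b
    have hp := hM.isPrime hs
    by_cases hab : Ideal.span {a, b} = ⊥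
    · have hb : b ∈ (⊥ : Ideal D) := hab ▸ Ideal.subset_span (by simp)
      exact ⟨1, hp.one_notMem, Or.inl (by simp [(Ideal.mem_bot).1 hb])⟩
    obtain ⟨c, hc, t, ht, htc⟩ := (h _ hab (Submodule.fg_span (Set.toFinite _))).exists_dvd
      hM.idealCl_eq hM.1.2
    obtain ⟨u, w, rfl⟩ := Ideal.mem_span_pair.1 hc
    obtain ⟨α, hα⟩ := htc a (Ideal.subset_span (by simp))
    obtain ⟨β, hβ⟩ := htc b (Ideal.subset_span (by simp))
    set c := u * a + w * b with hc'
    have ht0 : t ≠ 0 := fun h0 => ht (h0 ▸ M.zero_mem)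
    -- With `t a = c α`, `t b = c β` and `c = u a + w b`, cancelling `c` gives `t = u α + w β`. As
    -- `t ∉ M`, one of `α`, `β` is outside `M` and serves as denominator.
    have hαβ : α * b = β * a := mul_left_cancel₀ ht0 (by linear_combination α * hβ - β * hα)
    by_cases hαM : α ∈ M
    · by_cases hβM : β ∈ M
      · exfalso
        have hc0 : c ≠ 0 := by
          intro h0
          apply hab
          rw [h0, zero_mul, mul_eq_zero] at hα hβ
          rw [hα.resolve_left ht0, hβ.resolve_left ht0]
          simp
        have : t = u * α + w * β := mul_left_cancel₀ hc0 (by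
          linear_combination u * hα + w * hβ + t * hc')
        exact ht (this ▸ add_mem (M.mul_mem_left _ hαM) (M.mul_mem_left _ hβM))
      · exact ⟨β, hβM, Or.inr ⟨α, by rw [← hαβ]; ring⟩⟩
    · exact ⟨α, hαM, Or.inl ⟨β, by rw [hαβ]; ring⟩⟩
  · intro h I hI hfg
    refine isStarInvertible_of_forall hs hI fun M hM => ?_
    have := hM.isPrime hs
    exact (h M hM).exists_dvd_of_fg hfg

end StarOperation

/-! ### Localization at a prime and valuation ideals. -/

/-- The contraction to `D` of the extension of `J` to the localization at the prime `M`. -/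
def Ideal.localContraction {D : Type*} [CommRing D] (M : Ideal D) [hM : M.IsPrime] (J : Ideal D) :
    Ideal D where
  carrier := {x | ∃ t ∉ M, t * x ∈ J}
  zero_mem' := ⟨1, hM.one_notMem, by simp⟩
  add_mem' := by
    rintro x y ⟨t, ht, htx⟩ ⟨u, hu, huy⟩
    refine ⟨t * u, hM.mul_notMem ht hu, ?_⟩
    rw [show t * u * (x + y) = u * (t * x) + t * (u * y) by ring]
    exact add_mem (J.mul_mem_left _ htx) (J.mul_mem_left _ huy)
  smul_mem' := by
    rintro r x ⟨t, ht, htx⟩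
    refine ⟨t, ht, ?_⟩
    rw [smul_eq_mul, mul_left_comm]
    exact J.mul_mem_left _ htx

theorem Ideal.le_localContraction {D : Type*} [CommRing D] {M : Ideal D} [hM : M.IsPrime]
    {J : Ideal D} : J ≤ M.localContraction J :=
  fun x hx => ⟨1, hM.one_notMem, by rwa [one_mul]⟩

/-- Locally at `M`, multiplication by `v ∈ V` preserves divisibility by `c ^ n`, provided the result
stays in `D`. The stability of `I` under `V` gives one factor `c`; divide it out and induct. -/
theorem Ideal.exists_pow_dvd_mul {D K : Type*} [CommRing D] [Field K] [Algebra D K]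
    [IsFractionRing D K] {I M : Ideal D} {V : Subalgebra D K}
    (hV : ∀ j ∈ I, ∀ v ∈ V, ∀ y, algebraMap D K y = v * algebraMap D K j → y ∈ I)
    (hM : M.IsPrime) {c t : D} (hc : c ∈ I) (hc0 : c ≠ 0) (ht : t ∉ M)
    (htc : ∀ x ∈ I, c ∣ t * x) {v : K} (hv : v ∈ V) (n : ℕ) : ∀ x y : D, c ^ n ∣ x →
      algebraMap D K y = v * algebraMap D K x → ∃ u ∉ M, c ^ n ∣ u * y := by
  have hc0' : algebraMap D K c ≠ 0 := by simpa using hc0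
  induction n with
  | zero => exact fun x y _ _ => ⟨1, hM.one_notMem, by simp⟩
  | succ n ih =>
    rintro x y ⟨x, rfl⟩ hxy
    have hyI : y ∈ I := hV _ (I.mul_mem_right _ (I.pow_mem_of_mem hc _ n.succ_pos)) v hv y hxy
    obtain ⟨z, hz⟩ := htc y hyI
    obtain ⟨u, hu, r, hr⟩ := ih (c ^ n * (t * x)) z (dvd_mul_right _ _) (by
      have hz' := congrArg (algebraMap D K) hz
      apply mul_left_cancel₀ hc0'
      simp only [map_mul, map_pow] at hxy hz' ⊢
      linear_combination algebraMap D K t * hxy - hz')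
    exact ⟨u * t, hM.mul_notMem hu ht, r, by linear_combination u * hz + c * hr⟩

section Valuation

variable {D K : Type*} [CommRing D] [Field K] [Algebra D K] [IsFractionRing D K]
variable {I J M : Ideal D}

/-- The localization of `D` at a prime ideal, as a subalgebra of the quotient field. -/
def localSubalgebra (K : Type*) [Field K] [Algebra D K] (M : Ideal D) [hM : M.IsPrime] :
    Subalgebra D K where
  carrier := {x | ∃ t ∉ M, ∃ a, algebraMap D K t * x = algebraMap D K a}
  mul_mem' := by
    rintro x y ⟨t, ht, a, ha⟩ ⟨u, hu, b, hb⟩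
    exact ⟨t * u, hM.mul_notMem ht hu, a * b, by rw [map_mul, map_mul, ← ha, ← hb]; ring⟩
  add_mem' := by
    rintro x y ⟨t, ht, a, ha⟩ ⟨u, hu, b, hb⟩
    exact ⟨t * u, hM.mul_notMem ht hu, a * u + b * t, by
      rw [map_add, map_mul, map_mul, map_mul, ← ha, ← hb]; ring⟩
  algebraMap_mem' r := ⟨1, hM.one_notMem, r, by simp⟩

theorem valuationRing_localSubalgebra [hM : M.IsPrime] (h : M.IsEssentialPrime) :
    ValuationRing (localSubalgebra K M) := by
  have hne : ∀ t ∉ M, algebraMap D K t ≠ 0 := fun t ht h0 => ht (by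
    rw [(by simpa using h0 : t = 0)]; exact M.zero_mem)
  have key : ∀ x y : K, ∀ t ∉ M, ∀ u ∉ M, ∀ a b, algebraMap D K t * x = algebraMap D K a →
      algebraMap D K u * y = algebraMap D K b → ∀ w ∉ M, a ∣ w * b →
      ∃ z ∈ localSubalgebra K M, x * z = y := by
    rintro x y t ht u hu a b hx hy w hw ⟨r, hr⟩
    refine ⟨algebraMap D K t * algebraMap D K r / (algebraMap D K w * algebraMap D K u),
      ⟨w * u, hM.mul_notMem hw hu, t * r, ?_⟩, ?_⟩
    · have := hne w hw
      have := hne u hu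
      rw [map_mul, map_mul]
      field_simp
    · have := hne w hw
      have := hne u hu
      have hr' := congrArg (algebraMap D K) hr
      rw [map_mul, map_mul] at hr'
      field_simp
      linear_combination algebraMap D K r * hx - hr' - algebraMap D K w * hy
  refine { cond' := ?_ }
  rintro ⟨x, t, ht, a, hx⟩ ⟨y, u, hu, b, hy⟩
  obtain ⟨w, hw, hab | hab⟩ := h a b
  · obtain ⟨z, hz, hxz⟩ := key x y t ht u hu a b hx hy w hw hab
    exact ⟨⟨z, hz⟩, Or.inl (Subtype.ext hxz)⟩
  · obtain ⟨z, hz, hxz⟩ := key y x u hu t ht b a hy hx w hw hab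
    exact ⟨⟨z, hz⟩, Or.inr (Subtype.ext hxz)⟩

variable [IsDomain D]

theorem isValuationIdeal_localContraction [hM : M.IsPrime] (h : M.IsEssentialPrime) (J : Ideal D) :
    IsValuationIdeal K (M.localContraction J) := by
  refine ⟨localSubalgebra K M, valuationRing_localSubalgebra h, le_antisymm ?_ Ideal.le_comap_map⟩
  intro x hx
  rw [Ideal.mem_comap] at hx
  have key : ∀ y ∈ (M.localContraction J).map (algebraMap D (localSubalgebra K M)),
      ∃ t ∉ M, ∃ j ∈ J, algebraMap D K t * (y : K) = algebraMap D K j := by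
    intro y hy
    induction hy using Submodule.span_induction with
    | mem y hy =>
      obtain ⟨j, ⟨t, ht, htj⟩, rfl⟩ := hy
      exact ⟨t, ht, t * j, htj, by rw [map_mul]; rfl⟩
    | zero => exact ⟨1, hM.one_notMem, 0, J.zero_mem, by simp⟩
    | add y z _ _ hy hz =>
      obtain ⟨t, ht, i, hi, hy⟩ := hy
      obtain ⟨u, hu, j, hj, hz⟩ := hz
      refine ⟨t * u, hM.mul_notMem ht hu, u * i + t * j,
        add_mem (J.mul_mem_left _ hi) (J.mul_mem_left _ hj), ?_⟩
      rw [map_add, map_mul, map_mul, map_mul, ← hy, ← hz]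
      push_cast
      ring
    | smul r y _ hy =>
      obtain ⟨t, ht, i, hi, hy⟩ := hy
      obtain ⟨r, u, hu, a, hr⟩ := r
      refine ⟨u * t, hM.mul_notMem hu ht, a * i, J.mul_mem_left _ hi, ?_⟩
      rw [map_mul, map_mul, ← hy, ← hr]
      simp only [smul_eq_mul, MulMemClass.coe_mul]
      ring
  obtain ⟨t, ht, j, hj, hxj⟩ := key _ hx
  refine ⟨t, ht, ?_⟩
  have : algebraMap D K (t * x) = algebraMap D K j := by rw [map_mul, ← hxj]; rfl
  rwa [IsFractionRing.injective D K this]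

theorem isValuationIdeal_top : IsValuationIdeal K (⊤ : Ideal D) := by
  refine ⟨⊤, { cond' := ?_ }, by rw [Ideal.map_top, Ideal.comap_top]⟩
  rintro ⟨x, hx⟩ ⟨y, hy⟩
  by_cases h : x = 0
  · exact ⟨0, Or.inr (Subtype.ext (by simp [h]))⟩
  · exact ⟨⟨x⁻¹ * y, trivial⟩, Or.inl (Subtype.ext (mul_inv_cancel_left₀ h y))⟩

/-- The only two properties of the valuation overring used below: it compares elements of `D`, and
`J` absorbs its multiples that land in `D`. -/
theorem IsValuationIdeal.exists_subalgebra (hJ : IsValuationIdeal K J) : ∃ V : Subalgebra D K,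
    (∀ x y : D, (∃ v ∈ V, algebraMap D K y = v * algebraMap D K x) ∨
      ∃ v ∈ V, algebraMap D K x = v * algebraMap D K y) ∧
    ∀ j ∈ J, ∀ v ∈ V, ∀ y, algebraMap D K y = v * algebraMap D K j → y ∈ J := by
  obtain ⟨V, hV, hJV⟩ := hJ
  refine ⟨V, fun x y => ?_, fun j hj v hv y hy => ?_⟩
  · obtain ⟨⟨v, hv⟩, h | h⟩ := ValuationRing.cond (algebraMap D V x) (algebraMap D V y)
    · exact Or.inl ⟨v, hv, by rw [mul_comm]; exact (congrArg Subtype.val h).symm⟩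
    · exact Or.inr ⟨v, hv, by rw [mul_comm]; exact (congrArg Subtype.val h).symm⟩
  · rw [← hJV, Ideal.mem_comap]
    have : algebraMap D V y = ⟨v, hv⟩ * algebraMap D V j := Subtype.ext hy
    rw [this]
    exact Ideal.mul_mem_left _ _ (Ideal.mem_map_of_mem _ hj)

theorem IsValuationIdeal.sq_mem_or_sq_mem (hJ : IsValuationIdeal K J) {x y : D} (h : x * y ∈ J) :
    x ^ 2 ∈ J ∨ y ^ 2 ∈ J := by
  obtain ⟨V, htot, hV⟩ := hJ.exists_subalgebra
  rcases htot x y with ⟨v, hv, e⟩ | ⟨v, hv, e⟩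
  · exact Or.inr (hV _ h v hv _ (by rw [map_pow, map_mul]; linear_combination algebraMap D K y * e))
  · exact Or.inl (hV _ h v hv _ (by rw [map_pow, map_mul]; linear_combination algebraMap D K x * e))

theorem IsValuationIdeal.isPrime_radical (hJ : IsValuationIdeal K J) (h1 : J ≠ ⊤) :
    J.radical.IsPrime := by
  refine ⟨fun h => h1 (Ideal.radical_eq_top.1 h), ?_⟩
  rintro x y ⟨n, hn⟩
  rw [mul_pow] at hn
  rcases hJ.sq_mem_or_sq_mem hn with h | h
  · exact Or.inl ⟨n * 2, by rwa [pow_mul]⟩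
  · exact Or.inr ⟨n * 2, by rwa [pow_mul]⟩

end Valuation

/-! ### The implications between the conditions. -/

namespace StarOperation

variable {D K : Type*} [CommRing D] [IsDomain D] [Field K] [Algebra D K] [IsFractionRing D K]
variable {s : StarOperation D K} {I J M : Ideal D}

/-- An element of `Q_*` lies in `C_*` for a finitely generated `C ≤ Q`, and a local generator of `C`
divides it up to some `t ∉ M`. -/
theorem idealCl_eq_of_le_essential (hs : s.IsFiniteType) (hM : M.IsEssentialPrime) [M.IsPrime] {Q : Ideal D} (hQ : Q.IsPrime) (hQM : Q ≤ M) : s.idealCl Q = Q := by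
  refine le_antisymm (fun x hx => ?_) le_idealCl
  obtain ⟨C, hC, hCQ, hxC⟩ := (mem_idealCl_iff_exists_fg hs).1 hx
  obtain ⟨c, hc, t, ht, h⟩ := hM.exists_dvd_of_fg hC
  exact (hQ.mem_or_mem (Q.mem_of_dvd (dvd_of_mem_idealCl h hxC) (hCQ hc))).resolve_left
    fun h' => ht (hQM h')

theorem isTreed_of_essential (hs : s.IsFiniteType)
    (h : ∀ M : Ideal D, s.IsMaximalStarIdeal M → M.IsEssentialPrime) : s.IsTreed := by
  intro P Q R hP hQ hR hPR hQR
  obtain ⟨M, hM, -, hRM⟩ := exists_le_isMaximalStarIdeal hs hR.2.1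
    (by rw [(isStarIdeal_iff.1 hR.2).2]; exact hR.1.ne_top)
  by_contra! hcon
  obtain ⟨a, haP, haQ⟩ := Set.not_subset.1 hcon.1
  obtain ⟨b, hbQ, hbP⟩ := Set.not_subset.1 hcon.2
  obtain ⟨t, ht, hd | hd⟩ := h M hM a b
  · rcases hP.1.mem_or_mem (P.mem_of_dvd hd haP) with h' | h'
    · exact ht (hRM (hPR h'))
    · exact hbP h'
  · rcases hQ.1.mem_or_mem (Q.mem_of_dvd hd hbQ) with h' | h'
    · exact ht (hRM (hQR h'))
    · exact haQ h'

theorem isStarProdOfComaximalValuationIdeals_of_isHLocal (hs : s.IsFiniteType) (hh : s.IsHLocal)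
    (hess : ∀ M : Ideal D, s.IsMaximalStarIdeal M → M.IsEssentialPrime)
    (hI : s.IsStarIdeal I) : s.IsStarProdOfComaximalValuationIdeals I := by
  have hIs := isStarIdeal_iff.1 hI
  by_cases htop : I = ⊤
  -- No maximal `*`-ideal contains `⊤`, so the factor is supplied by hand.
  · refine ⟨1, fun _ => ⊤, le_rfl, fun _ => isValuationIdeal_top,
      fun i j hij => absurd (Subsingleton.elim i j) hij, ?_⟩
    rw [coe_eq_cl_iff, Finset.prod_const, Finset.card_univ, Fintype.card_fin, pow_one, idealCl_top,
      htop]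
  obtain ⟨a, haI, ha0⟩ := (Submodule.ne_bot_iff _).1 hIs.1
  have hS : {M : Ideal D | s.IsMaximalStarIdeal M ∧ I ≤ M}.Finite :=
    (hh.1 a ha0 fun hu => htop (Ideal.eq_top_of_isUnit_mem _ haI hu)).subset
      fun M hM => ⟨hM.1, hM.2 haI⟩
  obtain ⟨n, f, hfinj, hfrange⟩ := hS.fin_param
  have hfM : ∀ i, s.IsMaximalStarIdeal (f i) ∧ I ≤ f i := fun i => by
    have : f i ∈ Set.range f := ⟨i, rfl⟩
    rwa [hfrange] at this
  have hfp : ∀ i, (f i).IsPrime := fun i => (hfM i).1.isPrime hs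
  set J : Fin n → Ideal D := fun i => (f i).localContraction I with hJ
  have hval : ∀ i, IsValuationIdeal K (J i) := fun i =>
    isValuationIdeal_localContraction (hess _ (hfM i).1) I
  have hIJ : ∀ i, I ≤ J i := fun i => Ideal.le_localContraction
  have hJf : ∀ i, J i ≤ f i := by
    rintro i x ⟨t, ht, htx⟩
    exact ((hfp i).mem_or_mem ((hfM i).2 htx)).resolve_left ht
  -- The radical of `J i` is a prime `*`-ideal, so h-locality allows only one maximal `*`-ideal
  -- above it.
  have huniq : ∀ i M, s.IsMaximalStarIdeal M → J i ≤ M → M = f i := by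
    intro i M hM hJM
    have hMp := hM.isPrime hs
    have hrp := (hval i).isPrime_radical (fun h => (hfp i).ne_top (top_le_iff.1 (h ▸ hJf i)))
    have hrf : (J i).radical ≤ f i := (hfp i).radical_le_iff.2 (hJf i)
    have hrs := idealCl_eq_of_le_essential hs (hess _ (hfM i).1) hrp hrf
    have hr0 : (J i).radical ≠ ⊥ := fun h =>
      hIs.1 (le_bot_iff.1 (h ▸ (hIJ i).trans Ideal.le_radical))
    exact (hh.2 _ ⟨hrp, isStarIdeal_iff.2 ⟨hr0, hrs⟩⟩).unique
      ⟨hM, hMp.radical_le_iff.2 hJM⟩ ⟨(hfM i).1, hrf⟩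
  have hJ0 : ∀ i, J i ≠ ⊥ := fun i h => hIs.1 (le_bot_iff.1 (h ▸ hIJ i))
  refine ⟨n, J, ?_, hval, fun i j hij => ?_, ?_⟩
  · obtain ⟨M, hM, -, hIM⟩ := exists_le_isMaximalStarIdeal hs hIs.1 (by rwa [hIs.2])
    have : M ∈ Set.range f := by rw [hfrange]; exact ⟨hM, hIM⟩
    obtain ⟨i, -⟩ := this
    exact Nat.one_le_iff_ne_zero.2 (by rintro rfl; exact i.elim0)
  · rw [areStarComaximal_iff]
    by_contra hne
    obtain ⟨M, hM, -, hle⟩ := exists_le_isMaximalStarIdeal hs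
      (fun h => hJ0 i (le_bot_iff.1 (h ▸ le_sup_left))) hne
    exact hij (hfinj ((huniq i M hM (le_sup_left.trans hle)).symm.trans
      (huniq j M hM (le_sup_right.trans hle))))
  · rw [coe_eq_cl_iff]
    refine le_antisymm (fun x hx => mem_idealCl_of_forall hs ?_ fun M hM => ?_)
      (idealCl_le hIs.2 fun x hx => ?_)
    · rw [← Ideal.zero_eq_bot, Finset.prod_ne_zero_iff]
      exact fun i _ => hJ0 i
    · have hMp := hM.isPrime hs
      have hy : ∀ i, ∃ y ∈ J i, f i ≠ M → y ∉ M := by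
        intro i
        by_cases hi : f i = M
        · exact ⟨0, zero_mem _, fun h => absurd hi h⟩
        · obtain ⟨y, hy, hyM⟩ := Set.not_subset.1 fun hle => hi (huniq i M hM hle).symm
          exact ⟨y, hy, fun _ => hyM⟩
      choose y hyJ hyM using hy
      by_cases hex : ∃ i, f i = M
      · obtain ⟨i, rfl⟩ := hex
        refine ⟨∏ j ∈ Finset.univ.erase i, y j, ?_, ?_⟩
        · rw [hMp.prod_mem_iff]
          rintro ⟨j, hj, hj'⟩
          exact hyM j (fun h => (Finset.mem_erase.1 hj).1 (hfinj h)) hj'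
        · rw [mul_comm, ← Finset.mul_prod_erase Finset.univ J (Finset.mem_univ i)]
          exact Ideal.mul_mem_mul (hIJ i hx) (Ideal.prod_mem_prod fun j _ => hyJ j)
      · refine ⟨∏ j, y j, ?_, Ideal.mul_mem_right _ _ (Ideal.prod_mem_prod fun j _ => hyJ j)⟩
        rw [hMp.prod_mem_iff]
        rintro ⟨j, -, hj'⟩
        exact hyM j (fun h => hex ⟨j, h⟩) hj'
    · rw [← hIs.2]
      refine mem_idealCl_of_forall hs hIs.1 fun M hM => ?_
      by_cases hIM : I ≤ M
      · have : M ∈ Set.range f := by rw [hfrange]; exact ⟨hM, hIM⟩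
        obtain ⟨i, rfl⟩ := this
        exact (Finset.inf_le (Finset.mem_univ i) : _ ≤ J i) (Ideal.prod_le_inf hx)
      · obtain ⟨t, htI, htM⟩ := Set.not_subset.1 hIM
        exact ⟨t, htM, I.mul_mem_right _ htI⟩

theorem isStarInvertible_of_span_eq_prod {a : D} (ha : a ≠ 0) {n : ℕ} {J : Fin n → Ideal D}
    (h : Ideal.span {a} = s.idealCl (∏ i, J i)) (i : Fin n) : s.IsStarInvertible (J i) := by
  rw [← Finset.mul_prod_erase Finset.univ J (Finset.mem_univ i)] at h
  exact isStarInvertible_of_span_eq ha h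

theorem isTreed_of_comaximal
    (h : ∀ a : D, a ≠ 0 → s.IsStarProdOfComaximalValuationIdeals (Ideal.span {a})) :
    s.IsTreed := by
  intro P Q R hP hQ hR hPR hQR
  by_contra! hcon
  obtain ⟨a, haP, haQ⟩ := Set.not_subset.1 hcon.1
  obtain ⟨b, hbQ, hbP⟩ := Set.not_subset.1 hcon.2
  have ha0 : a ≠ 0 := fun h => haQ (h ▸ Q.zero_mem)
  have hb0 : b ≠ 0 := fun h => hbP (h ▸ P.zero_mem)
  have hRs := (isStarIdeal_iff.1 hR.2).2
  have hRp := hR.1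
  obtain ⟨n, J, -, hval, hco, hab⟩ := h (a * b) (mul_ne_zero ha0 hb0)
  rw [coe_eq_cl_iff] at hab
  have habJ : a * b ∈ s.idealCl (∏ i, J i) := hab ▸ Ideal.mem_span_singleton_self _
  have hJR : ∏ i, J i ≤ R := by
    refine (le_idealCl (s := s)).trans ?_
    rw [← hab]
    exact (Ideal.span_singleton_le_iff_mem _).2 (R.mul_mem_right _ (hPR haP))
  obtain ⟨i, -, hi⟩ := (hRp.prod_le).1 hJR
  have hy : ∀ j, ∃ y ∈ J j, j ≠ i → y ∉ R := by
    intro j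
    by_cases hj : j = i
    · exact ⟨0, zero_mem _, fun h => absurd hj h⟩
    · obtain ⟨y, hy, hyR⟩ := Set.not_subset.1 fun hle : J j ≤ R => hRp.ne_top (by
        have h1 := areStarComaximal_iff.1 (hco j i hj)
        exact top_le_iff.1 (h1 ▸ idealCl_le hRs (sup_le hle hi)))
      exact ⟨y, hy, fun _ => hyR⟩
  choose y hyJ hyR using hy
  set w := ∏ j ∈ Finset.univ.erase i, y j with hw
  have hwR : w ∉ R := by
    rw [hw, hRp.prod_mem_iff]
    rintro ⟨j, hj, hj'⟩
    exact hyR j (Finset.mem_erase.1 hj).1 hj'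
  -- Only `J i` lies in `R`; `w` lies in the product of the other factors and is a unit at `R`.
  have hwJ : ∀ z ∈ J i, a * b ∣ z * w := by
    intro z hz
    rw [← Ideal.mem_span_singleton, hab]
    refine le_idealCl ?_
    rw [← Finset.mul_prod_erase Finset.univ J (Finset.mem_univ i)]
    exact Ideal.mul_mem_mul hz (Ideal.prod_mem_prod fun j _ => hyJ j)
  obtain ⟨c, hc, t, ht, htc⟩ :=
    (isStarInvertible_of_span_eq_prod (mul_ne_zero ha0 hb0) hab i).exists_dvd hRs hRp.ne_top
  -- `J i` need not be `*`-closed, so `a * b` itself is only known to be in its closure; the local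
  -- generator `c` repairs this.
  have htab : t * (a * b) ∈ J i := by
    refine (J i).mem_of_dvd (dvd_of_mem_idealCl htc (idealCl_mono ?_ habJ)) hc
    exact Ideal.prod_le_inf.trans (Finset.inf_le (Finset.mem_univ i))
  obtain ⟨V, htot, hV⟩ := (hval i).exists_subalgebra
  rcases htot a b with ⟨v, hv, e⟩ | ⟨v, hv, e⟩
  · obtain ⟨r, hr⟩ := hwJ _ (hV _ htab v hv (t * (b * b)) (by
      simp only [map_mul]; linear_combination algebraMap D K t * algebraMap D K b * e))
    have h1 : t * b * w = a * r := mul_left_cancel₀ hb0 (by linear_combination hr)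
    have h2 : t * b * w ∈ P := h1 ▸ P.mul_mem_right _ haP
    exact hP.1.mul_notMem (hP.1.mul_notMem (fun h => ht (hPR h)) hbP) (fun h => hwR (hPR h)) h2
  · obtain ⟨r, hr⟩ := hwJ _ (hV _ htab v hv (t * (a * a)) (by
      simp only [map_mul]; linear_combination algebraMap D K t * algebraMap D K a * e))
    have h1 : t * a * w = b * r := mul_left_cancel₀ ha0 (by linear_combination hr)
    have h2 : t * a * w ∈ Q := h1 ▸ Q.mul_mem_right _ hbQ
    exact hQ.1.mul_notMem (hQ.1.mul_notMem (fun h => ht (hQR h)) haQ) (fun h => hwR (hQR h)) h2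

theorem exists_isStarInvertible_le_of_isVIFD (h : s.IsVIFD) {P : Ideal D} (hP : P.IsPrime)
    (hP0 : P ≠ ⊥) : ∃ I : Ideal D, I ≤ P ∧ s.IsStarInvertible I ∧ IsValuationIdeal K I := by
  obtain ⟨a, haP, ha0⟩ := (Submodule.ne_bot_iff _).1 hP0
  obtain ⟨n, J, -, hval, ha⟩ := h a ha0
  rw [coe_eq_cl_iff] at ha
  have hle : ∏ i, J i ≤ P := by
    refine (le_idealCl (s := s)).trans ?_
    rw [← ha]
    exact (Ideal.span_singleton_le_iff_mem _).2 haP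
  obtain ⟨i, -, hi⟩ := hP.prod_le.1 hle
  exact ⟨J i, hi, isStarInvertible_of_span_eq_prod ha0 ha i, hval i⟩

theorem isEssentialPrime_of_isTreed (hs : s.IsFiniteType) (htr : s.IsTreed)
    (h : ∀ P : Ideal D, P.IsPrime → P ≠ ⊥ →
      ∃ I : Ideal D, I ≤ P ∧ s.IsStarInvertible I ∧ IsValuationIdeal K I)
    (hM : s.IsMaximalStarIdeal M) : M.IsEssentialPrime := by
  intro a b
  have hMp := hM.isPrime hs
  by_cases hab0 : a * b = 0
  · refine ⟨1, hMp.one_notMem, ?_⟩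
    rcases mul_eq_zero.1 hab0 with h | h <;> simp [h]
  by_cases habM : a * b ∈ M
  swap
  · exact ⟨a, fun h => habM (M.mul_mem_right _ h), Or.inl (dvd_mul_right _ _)⟩
  -- Treedness makes `S` a chain, hence `sInf S` prime.
  set S : Set (Ideal D) := {Q | s.IsPrimeStarIdeal Q ∧ Q ≤ M ∧ a * b ∈ Q} with hS
  have hMS : M ∈ S := ⟨hM.isPrimeStarIdeal hs, le_rfl, habM⟩
  have hP : (sInf S).IsPrime := Ideal.sInf_isPrime_of_isChain ⟨M, hMS⟩
    (fun P hP Q hQ _ => htr P Q M hP.1 hQ.1 hMS.1 hP.2.1 hQ.2.1) fun Q hQ => hQ.1.1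
  have habP : a * b ∈ sInf S := Submodule.mem_sInf.2 fun Q hQ => hQ.2.2
  obtain ⟨I, hIP, hI, hIv⟩ := h _ hP fun h0 => hab0 ((Ideal.mem_bot).1 (h0 ▸ habP))
  obtain ⟨c, hc, t, ht, htc⟩ := hI.exists_dvd hM.idealCl_eq hM.1.2
  have hc0 : c ≠ 0 := Ideal.ne_zero_of_forall_dvd_mul hI.1 ht htc
  -- Otherwise a prime `*`-ideal containing `a * b` avoids both the complement of `M` and the powers
  -- of `c`. It belongs to `S`, yet `c ∈ I ≤ sInf S`.
  have hdiv : ∃ w ∉ M, ∃ n : ℕ, a * b ∣ w * c ^ n := by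
    by_contra! hcon
    obtain ⟨Q, habQ, hQp, hQs, hmax⟩ := exists_maximal_disjoint (J := Ideal.span {a * b}) hs
      (M.primeCompl ⊔ Submonoid.powers c) (by
        intro z hz hz'
        obtain ⟨w, hw, _, ⟨n, rfl⟩, rfl⟩ := Submonoid.mem_sup.1 hz
        rw [idealCl_span, Ideal.mem_span_singleton] at hz'
        exact hcon w hw n hz')
    have hdisj : ∀ t ∈ M.primeCompl ⊔ Submonoid.powers c, t ∉ Q := fun t ht h =>
      hmax.1 t ht (le_idealCl h)
    have habQ' : a * b ∈ Q := habQ (Ideal.mem_span_singleton_self _)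
    have hQM : Q ≤ M := fun x hx => by
      by_contra hxM
      exact hdisj x ((le_sup_left : M.primeCompl ≤ _) hxM) hx
    have hQS : Q ∈ S := ⟨⟨hQp, isStarIdeal_iff.2 ⟨fun h0 =>
      hab0 ((Ideal.mem_bot).1 (h0 ▸ habQ')), hQs⟩⟩, hQM, habQ'⟩
    exact hdisj c ((le_sup_right : Submonoid.powers c ≤ _) (Submonoid.mem_powers c))
      ((sInf_le hQS : sInf S ≤ Q) (hIP hc))
  obtain ⟨w, hw, n, r, hr⟩ := hdiv
  have hw0 : w ≠ 0 := fun h => hw (h ▸ M.zero_mem)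
  have habr : a * b * r ≠ 0 := hr ▸ mul_ne_zero hw0 (pow_ne_zero n hc0)
  have ha0 : a ≠ 0 := left_ne_zero_of_mul hab0
  have hb0 : b ≠ 0 := right_ne_zero_of_mul hab0
  have hr0 : r ≠ 0 := right_ne_zero_of_mul habr
  obtain ⟨V, htot, hV⟩ := hIv.exists_subalgebra
  rcases htot a b with ⟨v, hv, e⟩ | ⟨v, hv, e⟩
  -- With `b = v a`, multiplying `a b r = w c ^ n` by `v` gives `b b r`, which is thus locally
  -- divisible by `c ^ n`; cancelling `b r` leaves `a ∣ w u b`.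
  · obtain ⟨u, hu, z, hz⟩ := Ideal.exists_pow_dvd_mul hV hMp hc hc0 ht htc hv n (a * b * r) (b * b * r)
      (hr ▸ dvd_mul_left _ _) (by
        simp only [map_mul]; linear_combination algebraMap D K b * algebraMap D K r * e)
    exact ⟨w * u, hMp.mul_notMem hw hu, Or.inl ⟨z, mul_left_cancel₀ (mul_ne_zero hb0 hr0)
      (by linear_combination w * hz + z * hr)⟩⟩
  · obtain ⟨u, hu, z, hz⟩ := Ideal.exists_pow_dvd_mul hV hMp hc hc0 ht htc hv n (a * b * r) (a * a * r)
      (hr ▸ dvd_mul_left _ _) (by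
        simp only [map_mul]; linear_combination algebraMap D K a * algebraMap D K r * e)
    exact ⟨w * u, hMp.mul_notMem hw hu, Or.inr ⟨z, mul_left_cancel₀ (mul_ne_zero ha0 hr0)
      (by linear_combination w * hz + z * hr)⟩⟩

theorem eq_of_isStarInvertible_le (hs : s.IsFiniteType)
    (hess : ∀ M : Ideal D, s.IsMaximalStarIdeal M → M.IsEssentialPrime)
    (hI : s.IsStarInvertible I) (hIv : IsValuationIdeal K I) {M N : Ideal D}
    (hM : s.IsMaximalStarIdeal M) (hN : s.IsMaximalStarIdeal N) (hIM : I ≤ M) (hIN : I ≤ N) :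
    M = N := by
  obtain ⟨V, htot, hV⟩ := hIv.exists_subalgebra
  -- Compare `b` with a local generator `d` of `I` at `M`. If `b ∣ u d`, absorbing `v` forces `t c u
  -- ∈ M`; if `d ∣ u b`, then `u ^ 2` or `b ^ 2` lies in `I`.
  have key : ∀ M N : Ideal D, s.IsMaximalStarIdeal M → s.IsMaximalStarIdeal N → I ≤ M → I ≤ N →
      ∀ b ∈ M, b ∉ N → ∀ c ∉ M, ∀ v ∈ V, algebraMap D K c = v * algebraMap D K b → False := by
    intro M N hM hN hIM hIN b hbM hbN c hcM v hv e
    have hMp := hM.isPrime hs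
    have hNp := hN.isPrime hs
    have hb0 : b ≠ 0 := fun h => hbN (h ▸ N.zero_mem)
    obtain ⟨d, hd, t, ht, htd⟩ := hI.exists_dvd hM.idealCl_eq hM.1.2
    have hd0 : d ≠ 0 := Ideal.ne_zero_of_forall_dvd_mul hI.1 ht htd
    obtain ⟨u, hu, ⟨r, hr⟩ | hdvd⟩ := hess M hM b d
    · have hbr : b * r ∈ I := hr ▸ I.mul_mem_left _ hd
      have hcr : c * r ∈ I := hV _ hbr v hv _ (by
        simp only [map_mul]; linear_combination algebraMap D K r * e)
      obtain ⟨w, hw⟩ := htd _ hcr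
      have h1 : t * c * u = w * b := mul_left_cancel₀ hd0 (by
        linear_combination b * hw + t * c * hr)
      exact hMp.mul_notMem (hMp.mul_notMem ht hcM) hu (h1 ▸ M.mul_mem_left _ hbM)
    · rcases hIv.sq_mem_or_sq_mem (I.mem_of_dvd hdvd hd) with h | h
      · exact hu (hMp.mem_of_pow_mem _ (hIM h))
      · exact hbN (hNp.mem_of_pow_mem _ (hIN h))
  by_contra hne
  obtain ⟨b, hbM, hbN⟩ := hM.exists_mem_notMem hN hne
  obtain ⟨c, hcN, hcM⟩ := hN.exists_mem_notMem hM (Ne.symm hne)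
  rcases htot b c with ⟨v, hv, e⟩ | ⟨v, hv, e⟩
  · exact key M N hM hN hIM hIN b hbM hbN c hcM v hv e
  · exact key N M hN hM hIN hIM c hcN hcM b hbN v hv e

/-- A prime containing `B * C` contains `B` or `C`. The witness `C` is finitely generated so that
failure of the property passes to unions of chains. -/
theorem isOka_finite_maximalStarIdeals (hs : s.IsFiniteType) :
    Ideal.IsOka fun J : Ideal D => ∃ C : Ideal D, C.FG ∧ C ≤ J ∧
      {M : Ideal D | s.IsMaximalStarIdeal M ∧ C ≤ M}.Finite where
  top := by
    refine ⟨⊤, ⟨{1}, by simp⟩, le_rfl, Set.Finite.subset Set.finite_empty ?_⟩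
    rintro M ⟨hM, hle⟩
    exact hM.1.2 (top_le_iff.1 hle)
  oka := by
    rintro J a ⟨B, hB, hBJ, hBf⟩ ⟨C, hC, hCJ, hCf⟩
    refine ⟨B * C, hB.mul hC, ?_, (hBf.union hCf).subset ?_⟩
    · refine (Ideal.mul_mono hBJ hCJ).trans ?_
      rw [Ideal.sup_mul]
      refine sup_le Ideal.mul_le_left ?_
      rw [Ideal.span_singleton_mul_le_iff]
      intro z hz
      rw [mul_comm]
      exact Ideal.mem_colon_span_singleton.1 hz
    · rintro M ⟨hM, hle⟩
      exact ((hM.isPrime hs).mul_le.1 hle).imp (fun h => ⟨hM, h⟩) fun h => ⟨hM, h⟩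

theorem isHLocal_of_exists_isStarInvertible (hs : s.IsFiniteType)
    (hess : ∀ M : Ideal D, s.IsMaximalStarIdeal M → M.IsEssentialPrime)
    (h : ∀ P : Ideal D, P.IsPrime → P ≠ ⊥ →
      ∃ I : Ideal D, I ≤ P ∧ s.IsStarInvertible I ∧ IsValuationIdeal K I) : s.IsHLocal := by
  constructor
  · intro a ha0 _
    suffices hF : ∃ C : Ideal D, C.FG ∧ C ≤ Ideal.span {a} ∧
        {M : Ideal D | s.IsMaximalStarIdeal M ∧ C ≤ M}.Finite by
      obtain ⟨C, -, hC, hfin⟩ := hF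
      exact hfin.subset fun M hM =>
        ⟨hM.1, hC.trans ((Ideal.span_singleton_le_iff_mem _).2 hM.2)⟩
    by_contra hnot
    obtain ⟨P, haP, hP⟩ := zorn_le_nonempty₀ {J : Ideal D | ¬ ∃ C : Ideal D, C.FG ∧ C ≤ J ∧
        {M : Ideal D | s.IsMaximalStarIdeal M ∧ C ≤ M}.Finite}
      (fun c hc hchain I hI => ⟨sSup c, fun ⟨C, hC, hCc, hfin⟩ => by
        obtain ⟨L, hL, hCL⟩ := Ideal.exists_mem_of_fg_le_sSup_of_isChain ⟨I, hI⟩ hchain hC hCc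
        exact hc hL ⟨C, hC, hCL, hfin⟩, fun L hL => le_sSup hL⟩) _ hnot
    -- By the Oka property a maximal failure is prime. It contains a `*`-invertible valuation ideal,
    -- whose finitely generated part lies in at most one maximal `*`-ideal, a contradiction.
    have hPp : P.IsPrime := (isOka_finite_maximalStarIdeals hs).isPrime_of_maximal_not hP
    obtain ⟨I, hIP, hI, hIv⟩ := h P hPp fun h0 => ha0 (by simpa [h0] using haP)
    obtain ⟨C, hC, hCI, hCM⟩ := hI.exists_fg hs
    refine hP.1 ⟨C, hC, hCI.trans hIP, Set.Subsingleton.finite ?_⟩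
    rintro M ⟨hM, hCM'⟩ N ⟨hN, hCN⟩
    exact eq_of_isStarInvertible_le hs hess hI hIv hM hN (hCM M hM.idealCl_eq hCM')
      (hCM N hN.idealCl_eq hCN)
  · intro P hP
    obtain ⟨M, hM, -, hPM⟩ := exists_le_isMaximalStarIdeal hs hP.2.1
      (by rw [(isStarIdeal_iff.1 hP.2).2]; exact hP.1.ne_top)
    obtain ⟨I, hIP, hI, hIv⟩ := h P hP.1 hP.2.1
    exact ⟨M, ⟨hM, hPM⟩, fun N hN => eq_of_isStarInvertible_le hs hess hI hIv hN.1 hM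
      (hIP.trans hN.2) (hIP.trans hPM)⟩

theorem isStarFinite_span {a : D} (ha : a ≠ 0) : s.IsStarFinite (Ideal.span {a}) :=
  ⟨(Ideal.span {a} : Ideal D), FractionalIdeal.coeIdeal_ne_zero.2 (by simpa using ha),
    (FractionalIdeal.coeIdeal_fg _ (IsFractionRing.injective D K) _).2
      (Submodule.fg_span_singleton a), (isStarIdeal_span ha).2.symm⟩

theorem IsStarProdOfComaximalValuationIdeals.isStarProdOfValuationIdeals
    (h : s.IsStarProdOfComaximalValuationIdeals I) : s.IsStarProdOfValuationIdeals I := by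
  obtain ⟨n, J, hn, hval, -, hI⟩ := h
  exact ⟨n, J, hn, hval, hI⟩

end StarOperation

open StarOperation in
theorem theorem3p15 {D K : Type*} [CommRing D] [IsDomain D] [Field K] [Algebra D K]
    [IsFractionRing D K] (s : StarOperation D K) (hs : s.IsFiniteType) :
    List.TFAE [
      s.IsHLocal ∧ s.IsPruferStarMultiplicationDomain,
      ∀ I : Ideal D, s.IsStarIdeal I → s.IsStarProdOfComaximalValuationIdeals I,
      ∀ I : Ideal D, s.IsStarIdeal I → s.IsStarFinite I →
        s.IsStarProdOfComaximalValuationIdeals I,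
      ∀ a : D, a ≠ 0 → s.IsStarProdOfComaximalValuationIdeals (Ideal.span {a}),
      s.IsTreed ∧ s.IsVIFD,
      s.IsTreed ∧ ∀ P : Ideal D, P.IsPrime → P ≠ ⊥ →
        ∃ I : Ideal D, I ≤ P ∧ s.IsStarInvertible I ∧ IsValuationIdeal K I,
      s.IsTreed ∧ ∀ I : Ideal D, s.IsStarIdeal I → s.IsStarProdOfValuationIdeals I] := by
  rw [isPruferStarMultiplicationDomain_iff hs]
  tfae_have 1 → 2 := fun h I hI =>
    isStarProdOfComaximalValuationIdeals_of_isHLocal hs h.1 h.2 hI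
  tfae_have 2 → 3 := fun h I hI _ => h I hI
  tfae_have 3 → 4 := fun h a ha => h _ (isStarIdeal_span ha) (isStarFinite_span ha)
  tfae_have 4 → 5 := fun h =>
    ⟨isTreed_of_comaximal h, fun a ha => (h a ha).isStarProdOfValuationIdeals⟩
  tfae_have 5 → 6 := fun h =>
    ⟨h.1, fun _ hP hP0 => exists_isStarInvertible_le_of_isVIFD h.2 hP hP0⟩
  tfae_have 6 → 1 := fun h => by
    have hess : ∀ M : Ideal D, s.IsMaximalStarIdeal M → M.IsEssentialPrime :=
      fun _ hM => isEssentialPrime_of_isTreed hs h.1 h.2 hM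
    exact ⟨isHLocal_of_exists_isStarInvertible hs hess h.2, hess⟩
  tfae_have 1 → 7 := fun h => ⟨isTreed_of_essential hs h.2, fun _ hI =>
    (isStarProdOfComaximalValuationIdeals_of_isHLocal hs h.1 h.2 hI).isStarProdOfValuationIdeals⟩
  tfae_have 7 → 5 := fun h => ⟨h.1, fun _ ha => h.2 _ (isStarIdeal_span ha)⟩
  tfae_finish
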